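/- Let $F_n$ be the free group on a fixed basis $x_1,\dots,x_n$. For $i\neq j$ let $P_{ij}\in\mathrm{Aut}(F_n)$ be the automorphism sending $x_i$ to $x_jx_ix_j$ and fixing $x_l$ for all $l\neq i$, and let $\iota_i\in\mathrm{Aut}(F_n)$ be the automorphism sending $x_i$ to $x_i^{-1}$ and fixing $x_l$ for all $l\neq i$. Let $\mathrm{P\Pi A}_n$ be the subgroup of $\mathrm{Aut}(F_n)$ generated by all $P_{ij}$ ($i\ne j$) and all $\iota_i$ (the pure palindromic automorphism group), and for $0\le k\le n$ let $\mathrm{P\Pi A}_n(k)$ be the subgroup of those $\alpha\in \mathrm{P\Pi A}_n$ with $\alpha(x_i)=x_i$ for $1\le i\le k$. Let $\mathcal J_n(k)$ be the normal closure in $\mathrm{P\Pi A}_n(k)$ of the set $\{P_{ij} : i>k,\ j\le k\}$. **Proposition.** For all $0\le k\le n$ there is a split short exact sequence \[ 1\longrightarrow \mathcal J_n(k)\longrightarrow \mathrm{P\Pi A}_n(k)\stackrel{\theta_*}{\longrightarrow} \mathrm{P\Pi A}_{n-k}\longrightarrow 1, \] in which the first map is the inclusion and $\theta_*$ is induced by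 the homomorphism $\theta:F_n\to F_{n-k}$ that sends $x_1,\dots,x_k$ to $1$ and $x_{k+1},\dots,x_n$ to the basis elements of $F_{n-k}$ in order; that is, $\theta_*(\alpha)(\theta(w))=\theta(\alpha(w))$ for all $\alpha\in \mathrm{P\Pi A}_n(k)$ and $w\in F_n$. Here "split" means that $\theta_*$ has a section that is a group homomorphism. -/

import Mathlib

namespace Palindromic

/-- The endomorphism of the free group `F_n` on `x_0, …, x_{n-1}` that sends `x_i` to `w`
and fixes every other basis element. -/
def replaceHom {n : ℕ} (i : Fin n) (w : FreeGroup (Fin n)) :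
    FreeGroup (Fin n) →* FreeGroup (Fin n) :=
  FreeGroup.lift (Function.update FreeGroup.of i w)

theorem replaceHom_of_self {n : ℕ} (i : Fin n) (w : FreeGroup (Fin n)) :
    replaceHom i w (FreeGroup.of i) = w := by
  simp [replaceHom]

theorem replaceHom_of_ne {n : ℕ} {i l : Fin n} (h : l ≠ i) (w : FreeGroup (Fin n)) :
    replaceHom i w (FreeGroup.of l) = FreeGroup.of l := by
  simp [replaceHom, h]

/-- The elementary palindromic automorphism `P_ij` (for `i ≠ j`): it sends `x_i` to
`x_j x_i x_j` and fixes every other basis element. -/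
def elementary {n : ℕ} (i j : Fin n) (h : i ≠ j) : MulAut (FreeGroup (Fin n)) :=
  MonoidHom.toMulEquiv
    (replaceHom i (FreeGroup.of j * FreeGroup.of i * FreeGroup.of j))
    (replaceHom i ((FreeGroup.of j)⁻¹ * FreeGroup.of i * (FreeGroup.of j)⁻¹))
    (by
      refine FreeGroup.ext_hom _ _ fun l => ?_
      by_cases hl : l = i
      · subst hl
        simp [replaceHom_of_self, replaceHom_of_ne h.symm, mul_assoc]
      · simp [replaceHom_of_ne hl])
    (by
      refine FreeGroup.ext_hom _ _ fun l => ?_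
      by_cases hl : l = i
      · subst hl
        simp [replaceHom_of_self, replaceHom_of_ne h.symm, mul_assoc]
      · simp [replaceHom_of_ne hl])

/-- The inversion `ι_i`: it sends `x_i` to `x_i⁻¹` and fixes every other basis element. -/
def inversion {n : ℕ} (i : Fin n) : MulAut (FreeGroup (Fin n)) :=
  MonoidHom.toMulEquiv (replaceHom i (FreeGroup.of i)⁻¹) (replaceHom i (FreeGroup.of i)⁻¹)
    (by
      refine FreeGroup.ext_hom _ _ fun l => ?_
      by_cases hl : l = i
      · subst hl
        simp [replaceHom_of_self]
      · simp [replaceHom_of_ne hl])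
    (by
      refine FreeGroup.ext_hom _ _ fun l => ?_
      by_cases hl : l = i
      · subst hl
        simp [replaceHom_of_self]
      · simp [replaceHom_of_ne hl])

/-- The pure palindromic automorphism group `PΠA_n`, generated in `Aut(F_n)` by all elementary
palindromic automorphisms and all inversions. -/
def purePal (n : ℕ) : Subgroup (MulAut (FreeGroup (Fin n))) :=
  Subgroup.closure
    ({α | ∃ (i j : Fin n) (h : i ≠ j), α = elementary i j h} ∪ {α | ∃ i : Fin n, α = inversion i})

/-- The subgroup `PΠA_n(k)` of `PΠA_n` of those automorphisms that fix the first `k` basis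
elements (those with index `< k`, as indices start from `0`). -/
def pureFix (n k : ℕ) : Subgroup (MulAut (FreeGroup (Fin n))) where
  carrier := {α | α ∈ purePal n ∧
    ∀ i : Fin n, (i : ℕ) < k → α (FreeGroup.of i) = FreeGroup.of i}
  one_mem' := ⟨one_mem _, fun _ _ => rfl⟩
  mul_mem' := fun {α β} ha hb => ⟨mul_mem ha.1 hb.1, fun i hi => by
    rw [MulAut.mul_apply, hb.2 i hi, ha.2 i hi]⟩
  inv_mem' := fun {α} ha => ⟨inv_mem ha.1, fun i hi => by
    rw [MulAut.inv_apply, MulEquiv.symm_apply_eq, ha.2 i hi]⟩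

/-- The group `J_n(k)`: the normal closure in `PΠA_n(k)` of the `P_ij` for which `x_i` is not,
and `x_j` is, among the first `k` basis elements. -/
def birmanKernel (n k : ℕ) : Subgroup (pureFix n k) :=
  Subgroup.normalClosure
    {α | ∃ (i j : Fin n) (h : i ≠ j), k ≤ (i : ℕ) ∧ (j : ℕ) < k ∧
      (α : MulAut (FreeGroup (Fin n))) = elementary i j h}

/-- The homomorphism `F_n → F_{n-k}` that kills the first `k` basis elements and sends the
remaining ones, in order, to the basis of `F_{n-k}`. -/
def kill (n k : ℕ) : FreeGroup (Fin n) →* FreeGroup (Fin (n - k)) :=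
  FreeGroup.lift fun i : Fin n =>
    if h : k ≤ (i : ℕ) then FreeGroup.of ⟨(i : ℕ) - k, by omega⟩ else 1

end Palindromic

/-!
Every element `α` of `PΠA_n` commutes with the involution inverting all basis elements and acts
trivially on `H₁(F_n; ℤ/2)`, so it maps each letter to a palindrome of odd length. If among the left
halves of these palindromes (middle letter included) none is a prefix of another, then in the image
of a reduced word the left half belonging to the first letter survives cancellation; as `α` is onto,
all these left halves are then single letters and `α` maps each `x_i` to `x_i` or `x_i⁻¹`. Otherwise
the left half of the image of a letter `s` is a prefix of that of `x_i`, up to inverting `x_i`, and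
the length of `α(x_i)` drops when `α` is composed with some `P_ij` or its inverse. A basis element
that `α` fixes has an image of length one, which cannot drop, so this reduction never moves it:
`PΠA_n(k)` is generated by the `P_ij` and `ι_i` with `i > k`. Each of these lies in `J_n(k)` or in
the image of the section that extends automorphisms of `F_{n-k}` by the identity. As `J_n(k)` is
contained in the kernel of `θ_*`, it is equal to it.
-/

namespace Palindromic

open FreeGroup (of mk IsReduced invRev)

section Words

variable {A : Type*}

theorem exists_eq_append_cons_of_not_prefix {l m : List A} (hl : ¬ l <+: m) (hm : ¬ m <+: l) :
    ∃ c d d' f f', d ≠ d' ∧ l = c ++ d :: f ∧ m = c ++ d' :: f' := by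
  induction l generalizing m with
  | nil => exact absurd List.nil_prefix hl
  | cons a l ih =>
    cases m with
    | nil => exact absurd List.nil_prefix hm
    | cons b m =>
      by_cases hab : a = b
      · subst hab
        simp only [List.cons_prefix_cons, true_and] at hl hm
        obtain ⟨c, d, d', f, f', hd, rfl, rfl⟩ := ih hl hm
        exact ⟨a :: c, d, d', f, f', hd, rfl, rfl⟩
      · exact ⟨[], a, b, l, m, hab, rfl, rfl⟩

/-- The left half of a word, including the middle letter if the length is odd. -/
def leftHalf (l : List A) : List A := l.take ((l.length + 1) / 2)

theorem leftHalf_prefix (l : List A) : leftHalf l <+: l := List.take_prefix _ _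

theorem length_leftHalf (l : List A) : (leftHalf l).length = (l.length + 1) / 2 := by
  rw [leftHalf, List.length_take]
  omega

theorem palindrome_eq_append_reverse {l p : List A} (hl : l.Palindrome) (hp : p <+: l)
    (hlen : 2 * p.length ≤ l.length) : ∃ z, l = p ++ z ++ p.reverse := by
  obtain ⟨q, rfl⟩ := hp
  have hsuffix : p.reverse <:+ p ++ q := by
    rw [← hl.reverse_eq, List.reverse_append]
    exact List.suffix_append _ _
  obtain ⟨z, rfl⟩ : p.reverse <:+ q := List.suffix_of_suffix_length_le hsuffix
    (List.suffix_append _ _) (by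
      rw [List.length_append] at hlen
      rw [List.length_reverse]
      omega)
  exact ⟨z, by simp⟩

theorem palindrome_eq_leftHalf_append {l : List A} (hl : l.Palindrome) (hodd : Odd l.length) :
    l = leftHalf l ++ (leftHalf l).dropLast.reverse := by
  obtain ⟨m, hm⟩ := hodd
  have hhalf : leftHalf l = l.take (m + 1) := by rw [leftHalf]; congr 1; omega
  have hdrop : l.drop (m + 1) = (l.take m).reverse := by
    conv_lhs => rw [← hl.reverse_eq, List.drop_reverse]
    congr 2; omega
  have hlast : (l.take (m + 1)).dropLast = l.take m := by
    rw [List.dropLast_eq_take, List.take_take, List.length_take]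
    congr 1; omega
  rw [hhalf, hlast, ← hdrop, List.take_append_drop]

theorem eq_of_leftHalf_eq {l m : List A} (hl : l.Palindrome) (hm : m.Palindrome)
    (hlodd : Odd l.length) (hmodd : Odd m.length) (h : leftHalf l = leftHalf m) : l = m := by
  rw [palindrome_eq_leftHalf_append hl hlodd, palindrome_eq_leftHalf_append hm hmodd, h]

end Words

section Reduced

variable {X Y : Type*} [DecidableEq Y]

theorem norm_eq_length_toWord (x : FreeGroup Y) : x.norm = x.toWord.length := rfl

theorem toWord_mul_of_inv_common_prefix {x y : FreeGroup Y} {c f f' : List (Y × Bool)}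
    {d d' : Y × Bool} (hx : x⁻¹.toWord = c ++ d :: f) (hy : y.toWord = c ++ d' :: f')
    (hd : d ≠ d') : (x * y).toWord = invRev (d :: f) ++ d' :: f' := by
  have hx' : x.toWord = invRev (d :: f) ++ invRev c := by
    rw [← FreeGroup.invRev_append, ← hx, FreeGroup.toWord_inv, FreeGroup.invRev_invRev]
  have hxred : IsReduced (invRev (d :: f)) :=
    FreeGroup.isReduced_toWord.infix (hx' ▸ (List.prefix_append _ _).isInfix)
  have hyred : IsReduced (d' :: f') :=
    FreeGroup.isReduced_toWord.infix (hy ▸ (List.suffix_append _ _).isInfix)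
  have hred : IsReduced (invRev (d :: f) ++ d' :: f') := by
    refine List.IsChain.append hxred hyred fun a ha b hb hab => ?_
    obtain rfl : (d.1, !d.2) = a := by simpa [invRev] using ha
    obtain rfl : d' = b := by simpa using hb
    exact Bool.not_eq.2 fun h => hd (Prod.ext hab h)
  have hmul : x * y = mk (invRev (d :: f) ++ d' :: f') := by
    rw [← FreeGroup.mk_toWord (x := x), ← FreeGroup.mk_toWord (x := y), hx', hy]
    simp only [← FreeGroup.mul_mk, ← FreeGroup.inv_mk]
    group
  rw [hmul, FreeGroup.toWord_mk, hred.reduce_eq]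

theorem prefix_toWord_mul {x y : FreeGroup Y} {p q r : List (Y × Bool)}
    (hp : p <+: x⁻¹.toWord) (hq : q <+: y.toWord) (hpq : ¬ p <+: q) (hqp : ¬ q <+: p)
    (hr : r <+: x.toWord) (hlen : r.length + p.length ≤ x.norm + 1) : r <+: (x * y).toWord := by
  obtain ⟨c, d, d', f, f', hd, rfl, rfl⟩ := exists_eq_append_cons_of_not_prefix hpq hqp
  obtain ⟨g, hg⟩ := hp
  obtain ⟨g', hg'⟩ := hq
  rw [List.append_assoc, List.cons_append] at hg hg'
  have hx : x.toWord = invRev (d :: (f ++ g)) ++ invRev c := by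
    rw [← FreeGroup.invRev_append, hg, FreeGroup.toWord_inv, FreeGroup.invRev_invRev]
  have hr' : r <+: invRev (d :: (f ++ g)) := by
    refine List.prefix_of_prefix_length_le hr (hx ▸ List.prefix_append _ _) ?_
    rw [norm_eq_length_toWord, hx] at hlen
    simp only [List.length_append, List.length_cons, FreeGroup.invRev_length] at hlen ⊢
    omega
  rw [toWord_mul_of_inv_common_prefix hg.symm hg'.symm hd]
  exact hr'.trans (List.prefix_append _ _)

theorem prefix_toWord_map_mk_cons (φ : FreeGroup X →* FreeGroup Y)
    (P : X × Bool → List (Y × Bool)) (hP : ∀ s, P s <+: (φ (mk [s])).toWord)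
    (hlen : ∀ s, (P s).length + (P (s.1, !s.2)).length ≤ (φ (mk [s])).norm + 1)
    (hcode : ∀ s t, P s <+: P t → s = t) {s : X × Bool} {L : List (X × Bool)}
    (hL : IsReduced (s :: L)) : P s <+: (φ (mk (s :: L))).toWord := by
  induction L generalizing s with
  | nil => exact hP s
  | cons b L ih =>
    obtain ⟨hsb, hL⟩ := FreeGroup.isReduced_cons_cons.1 hL
    have hne : (s.1, !s.2) ≠ b := by
      rintro rfl
      simp at hsb
    have hinv : P (s.1, !s.2) <+: (φ (mk [s]))⁻¹.toWord := by
      rw [← map_inv]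
      exact hP (s.1, !s.2)
    have hmul : φ (mk (s :: b :: L)) = φ (mk [s]) * φ (mk (b :: L)) := by
      rw [← map_mul, FreeGroup.mul_mk, List.singleton_append]
    rw [hmul]
    exact prefix_toWord_mul hinv (ih hL) (fun h => hne (hcode _ _ h))
      (fun h => hne (hcode _ _ h).symm) (hP s) (hlen s)

theorem norm_inv_mul_mul_inv_lt {x y : FreeGroup Y} {p : List (Y × Bool)}
    (hx : x.toWord.Palindrome) (hy : y.toWord.Palindrome) (hpx : p <+: x.toWord)
    (hpy : p <+: y.toWord) (hxlen : x.norm < 2 * p.length) (hylen : 2 * p.length ≤ y.norm) :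
    (x⁻¹ * y * x⁻¹).norm < y.norm := by
  obtain ⟨v, hv⟩ := hpx
  obtain ⟨z, hz⟩ := palindrome_eq_append_reverse hy hpy hylen
  have hv' : v.reverse ++ p.reverse = x.toWord := by
    rw [← List.reverse_append, hv, hx.reverse_eq]
  have hprod : x⁻¹ * y * x⁻¹ = mk (invRev v ++ z ++ invRev v.reverse) := by
    have hleft : x = mk p * mk v := by rw [FreeGroup.mul_mk, hv, FreeGroup.mk_toWord]
    have hright : x = mk v.reverse * mk p.reverse := by
      rw [FreeGroup.mul_mk, hv', FreeGroup.mk_toWord]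
    have hmid : y = mk p * mk z * mk p.reverse := by
      rw [FreeGroup.mul_mk, FreeGroup.mul_mk, ← hz, FreeGroup.mk_toWord]
    rw [← FreeGroup.mul_mk, ← FreeGroup.mul_mk, ← FreeGroup.inv_mk, ← FreeGroup.inv_mk, hmid]
    nth_rw 1 [hleft]
    rw [hright]
    group
  calc (x⁻¹ * y * x⁻¹).norm ≤ (invRev v ++ z ++ invRev v.reverse).length :=
        hprod ▸ FreeGroup.norm_mk_le
    _ < y.norm := by
      rw [norm_eq_length_toWord] at hxlen ⊢
      rw [← hv] at hxlen
      rw [hz]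
      simp only [List.length_append, FreeGroup.invRev_length, List.length_reverse] at hxlen ⊢
      omega

end Reduced

section Automorphisms

variable {X : Type*}

theorem mulAut_ext {α β : MulAut (FreeGroup X)} (h : ∀ i, α (of i) = β (of i)) : α = β :=
  MulEquiv.toMonoidHom_injective (FreeGroup.ext_hom _ _ h)

variable (X) in
/-- The hyperelliptic involution of a free group: the automorphism that inverts every element of
the basis. -/
def invertBasis : MulAut (FreeGroup X) :=
  MonoidHom.toMulEquiv (FreeGroup.lift fun i => (of i)⁻¹) (FreeGroup.lift fun i => (of i)⁻¹)
    (by ext; simp) (by ext; simp)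

@[simp]
theorem invertBasis_of (i : X) : invertBasis X (of i) = (of i)⁻¹ := by
  simp [invertBasis]

theorem invertBasis_mk_singleton (s : X × Bool) : invertBasis X (mk [s]) = (mk [s])⁻¹ := by
  obtain ⟨i, _ | _⟩ := s
  · exact (map_inv (invertBasis X) (of i)).trans (congrArg _ (invertBasis_of i))
  · exact invertBasis_of i

theorem inv_invertBasis_mk (L : List (X × Bool)) : (invertBasis X (mk L))⁻¹ = mk L.reverse := by
  induction L with
  | nil => exact inv_eq_one.2 (map_one _)
  | cons s L ih =>
    rw [← List.singleton_append, ← FreeGroup.mul_mk, map_mul, mul_inv_rev, ih,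
      invertBasis_mk_singleton, inv_inv, FreeGroup.mul_mk, List.reverse_append,
      List.reverse_singleton]

variable (X) in
/-- The level two congruence subgroup of `Aut(F_X)`: the automorphisms that act trivially on
`H₁(F_X; ℤ/2)`, that is, on the homomorphisms to `ℤ/2`. -/
def levelTwo : Subgroup (MulAut (FreeGroup X)) where
  carrier := {α | ∀ (φ : FreeGroup X →* Multiplicative (ZMod 2)) (w : FreeGroup X), φ (α w) = φ w}
  one_mem' _ _ := rfl
  mul_mem' hα hβ φ w := (hα φ _).trans (hβ φ w)
  inv_mem' {α} hα φ w := by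
    rw [← hα φ, MulAut.apply_inv_self]

theorem mem_levelTwo_of_forall_of {α : MulAut (FreeGroup X)}
    (h : ∀ (φ : FreeGroup X →* Multiplicative (ZMod 2)) (i : X), φ (α (of i)) = φ (of i)) :
    α ∈ levelTwo X := fun φ =>
  DFunLike.congr_fun (FreeGroup.ext_hom (φ.comp α.toMonoidHom) φ (h φ))

theorem fst_eq_of_apply_mk_singleton_eq {α : MulAut (FreeGroup X)} (hα : α ∈ levelTwo X)
    {s t : X × Bool} (h : α (mk [s]) = mk [t]) : s.1 = t.1 := by
  classical
  by_contra hst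
  have := hα (FreeGroup.lift (Pi.mulSingle t.1 (Multiplicative.ofAdd 1))) (mk [s])
  rw [h] at this
  obtain ⟨j, _ | _⟩ := t <;> obtain ⟨i, _ | _⟩ := s <;>
    simp [Pi.mulSingle_apply, hst] at this

variable [DecidableEq X]

theorem reverse_toWord_eq_of_invertBasis_eq_inv {w : FreeGroup X} (h : invertBasis X w = w⁻¹) :
    w.toWord.reverse = w.toWord := by
  have hred : IsReduced w.toWord.reverse :=
    List.isChain_reverse.2 (FreeGroup.isReduced_toWord.imp fun _ _ hst hts => (hst hts.symm).symm)
  have hmk : mk w.toWord.reverse = w := by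
    rw [← inv_invertBasis_mk, FreeGroup.mk_toWord, h, inv_inv]
  rw [← hred.reduce_eq, ← FreeGroup.toWord_mk, hmk]

theorem palindrome_toWord_apply_mk_singleton {α : MulAut (FreeGroup X)}
    (hα : α ∈ Subgroup.centralizer {invertBasis X}) (s : X × Bool) :
    (α (mk [s])).toWord.Palindrome := by
  refine .of_reverse_eq (reverse_toWord_eq_of_invertBasis_eq_inv ?_)
  rw [← map_inv, ← invertBasis_mk_singleton, ← MulAut.mul_apply, ← MulAut.mul_apply,
    Subgroup.mem_centralizer_singleton_iff.1 hα]

theorem lift_const_ofAdd_one_apply (w : FreeGroup X) :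
    FreeGroup.lift (fun _ => Multiplicative.ofAdd (1 : ZMod 2)) w =
      Multiplicative.ofAdd (w.norm : ZMod 2) := by
  have hletter (b : Bool) : (cond b (Multiplicative.ofAdd (1 : ZMod 2))
      (Multiplicative.ofAdd 1)⁻¹) = Multiplicative.ofAdd 1 := by
    cases b <;> rfl
  conv_lhs => rw [← FreeGroup.mk_toWord (x := w), FreeGroup.lift_mk]
  simp only [hletter, List.map_const', List.prod_replicate]
  rw [← ofAdd_nsmul, nsmul_one, norm_eq_length_toWord]

theorem natCast_norm_apply_of_mem_levelTwo {α : MulAut (FreeGroup X)} (hα : α ∈ levelTwo X)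
    (w : FreeGroup X) : ((α w).norm : ZMod 2) = w.norm := by
  have := hα (FreeGroup.lift fun _ => Multiplicative.ofAdd 1) w
  rwa [lift_const_ofAdd_one_apply, lift_const_ofAdd_one_apply] at this

theorem norm_mk_singleton (s : X × Bool) : (mk [s]).norm = 1 := by
  rw [norm_eq_length_toWord, FreeGroup.toWord_mk, FreeGroup.reduce_singleton, List.length_singleton]

theorem odd_norm_apply_mk_singleton {α : MulAut (FreeGroup X)} (hα : α ∈ levelTwo X)
    (s : X × Bool) : Odd (α (mk [s])).norm := by
  rw [← ZMod.natCast_eq_one_iff_odd, natCast_norm_apply_of_mem_levelTwo hα, norm_mk_singleton,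
    Nat.cast_one]

end Automorphisms

section Dichotomy

variable {X : Type*} [DecidableEq X] {α : MulAut (FreeGroup X)}

theorem norm_apply_mk_singleton_not (α : MulAut (FreeGroup X)) (s : X × Bool) :
    (α (mk [(s.1, !s.2)])).norm = (α (mk [s])).norm := by
  rw [← FreeGroup.norm_inv_eq, ← map_inv, FreeGroup.inv_mk]
  simp [invRev]

theorem apply_of_eq_or_eq_inv_of_forall_leftHalf_prefix (hα : α ∈ levelTwo X)
    (hcode : ∀ s t : X × Bool,
      leftHalf (α (mk [s])).toWord <+: leftHalf (α (mk [t])).toWord → s = t) (i : X) :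
    α (of i) = of i ∨ α (of i) = (of i)⁻¹ := by
  obtain ⟨s, L, hL⟩ : ∃ s L, (α⁻¹ (of i)).toWord = s :: L := by
    refine List.exists_cons_of_ne_nil fun h => FreeGroup.of_ne_one i ?_
    rwa [FreeGroup.toWord_eq_nil_iff, map_eq_one_iff _ (MulEquiv.injective _)] at h
  have hodd : Odd (α (mk [s])).toWord.length := odd_norm_apply_mk_singleton hα s
  have hpre : leftHalf (α (mk [s])).toWord <+: [(i, true)] := by
    have := prefix_toWord_map_mk_cons α.toMonoidHom (fun s => leftHalf (α (mk [s])).toWord)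
      (fun s => leftHalf_prefix _) (fun t => ?_) hcode (hL ▸ FreeGroup.isReduced_toWord)
    · rwa [← hL, FreeGroup.mk_toWord, MulEquiv.coe_toMonoidHom, MulAut.apply_inv_self,
        FreeGroup.toWord_of] at this
    · have := norm_apply_mk_singleton_not α t
      simp only [length_leftHalf, norm_eq_length_toWord, MulEquiv.coe_toMonoidHom] at this ⊢
      omega
  have hlen : (α (mk [s])).toWord.length = 1 := by
    have := hpre.length_le
    rw [length_leftHalf, List.length_singleton] at this
    grind
  have hs : α (mk [s]) = of i := by
    rw [leftHalf, hlen, List.take_of_length_le hlen.le] at hpre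
    rw [← FreeGroup.toWord_inj, hpre.eq_of_length hlen, FreeGroup.toWord_of]
  obtain rfl : s.1 = i := fst_eq_of_apply_mk_singleton_eq hα hs
  obtain ⟨j, _ | _⟩ := s
  · exact .inr (inv_eq_iff_eq_inv.1 ((map_inv α (of j)).symm.trans hs))
  · exact .inl hs

theorem fst_ne_and_norm_lt_of_leftHalf_prefix (hαι : α ∈ Subgroup.centralizer {invertBasis X})
    (hα : α ∈ levelTwo X) {s t : X × Bool} (hst : s ≠ t)
    (hpre : leftHalf (α (mk [s])).toWord <+: leftHalf (α (mk [t])).toWord) :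
    s.1 ≠ t.1 ∧ ((α (mk [s]))⁻¹ * α (mk [t]) * (α (mk [s]))⁻¹).norm < (α (mk [t])).norm := by
  have hpal := palindrome_toWord_apply_mk_singleton hαι
  have hodd := odd_norm_apply_mk_singleton hα
  have hlen : (α (mk [s])).norm < (α (mk [t])).norm := by
    by_contra! hle
    have heq := eq_of_leftHalf_eq (hpal s) (hpal t) (hodd s) (hodd t) (hpre.eq_of_length_le ?_)
    · have hmk : mk [s] = mk [t] := α.injective (FreeGroup.toWord_injective heq)
      have := congrArg FreeGroup.toWord hmk
      simp [hst] at this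
    · rw [length_leftHalf, length_leftHalf]
      exact Nat.div_le_div_right (Nat.add_le_add_right hle 1)
  refine ⟨fun hfst => ?_, ?_⟩
  · have ht : t = (s.1, !s.2) :=
      Prod.ext hfst.symm (Bool.eq_not.2 fun h => hst (Prod.ext hfst h.symm))
    rw [ht, norm_apply_mk_singleton_not] at hlen
    exact hlen.false
  · obtain ⟨a, ha⟩ := hodd s
    obtain ⟨b, hb⟩ := hodd t
    refine norm_inv_mul_mul_inv_lt (hpal s) (hpal t) (leftHalf_prefix _)
      (hpre.trans (leftHalf_prefix _)) ?_ ?_ <;>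
    · rw [length_leftHalf, ← norm_eq_length_toWord]
      omega

theorem forall_apply_of_eq_or_exists_norm_lt (hαι : α ∈ Subgroup.centralizer {invertBasis X})
    (hα : α ∈ levelTwo X) :
    (∀ i, α (of i) = of i ∨ α (of i) = (of i)⁻¹) ∨
      ∃ (i : X) (s : X × Bool), s.1 ≠ i ∧
        (α (mk [s] * of i * mk [s])).norm < (α (of i)).norm := by
  by_cases hcode : ∀ s t : X × Bool,
      leftHalf (α (mk [s])).toWord <+: leftHalf (α (mk [t])).toWord → s = t
  · exact .inl (apply_of_eq_or_eq_inv_of_forall_leftHalf_prefix hα hcode)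
  push Not at hcode
  obtain ⟨s, ⟨i, b⟩, hpre, hst⟩ := hcode
  obtain ⟨hfst, hlt⟩ := fst_ne_and_norm_lt_of_leftHalf_prefix hαι hα hst hpre
  rw [← map_inv, ← map_mul, ← map_mul] at hlt
  cases b with
  | true => exact .inr ⟨i, (s.1, !s.2), hfst, hlt⟩
  | false =>
    refine .inr ⟨i, s, hfst, ?_⟩
    have hinv : (mk [s] * of i * mk [s])⁻¹ = (mk [s])⁻¹ * mk [(i, false)] * (mk [s])⁻¹ := by
      rw [mul_inv_rev, mul_inv_rev, ← mul_assoc]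
      rfl
    rw [← hinv, map_inv, FreeGroup.norm_inv_eq] at hlt
    exact hlt.trans_eq (norm_apply_mk_singleton_not α (i, true))

end Dichotomy

section Generators

variable {n : ℕ}

theorem elementary_of_self {i j : Fin n} (h : i ≠ j) :
    elementary i j h (of i) = of j * of i * of j :=
  replaceHom_of_self _ _

theorem elementary_of_ne {i j l : Fin n} (h : i ≠ j) (hl : l ≠ i) :
    elementary i j h (of l) = of l :=
  replaceHom_of_ne hl _

theorem inv_elementary_of_self {i j : Fin n} (h : i ≠ j) :
    (elementary i j h)⁻¹ (of i) = (of j)⁻¹ * of i * (of j)⁻¹ :=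
  replaceHom_of_self _ _

theorem inv_elementary_of_ne {i j l : Fin n} (h : i ≠ j) (hl : l ≠ i) :
    (elementary i j h)⁻¹ (of l) = of l :=
  replaceHom_of_ne hl _

theorem inversion_of_self (i : Fin n) : inversion i (of i) = (of i)⁻¹ :=
  replaceHom_of_self _ _

theorem inversion_of_ne {i l : Fin n} (hl : l ≠ i) : inversion i (of l) = of l :=
  replaceHom_of_ne hl _

/-- The elementary palindromic automorphisms `P_ij` and the inversions `ι_i` with `i ∈ A`, that is,
those that fix the basis elements `x_i` with `i ∉ A`. -/
def palGenerators (A : Set (Fin n)) : Set (MulAut (FreeGroup (Fin n))) :=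
  {α | ∃ (i j : Fin n) (h : i ≠ j), i ∈ A ∧ α = elementary i j h} ∪
    {α | ∃ i ∈ A, α = inversion i}

theorem elementary_mem_closure {A : Set (Fin n)} {i j : Fin n} (h : i ≠ j) (hi : i ∈ A) :
    elementary i j h ∈ Subgroup.closure (palGenerators A) :=
  Subgroup.subset_closure (.inl ⟨i, j, h, hi, rfl⟩)

theorem inversion_mem_closure {A : Set (Fin n)} {i : Fin n} (hi : i ∈ A) :
    inversion i ∈ Subgroup.closure (palGenerators A) :=
  Subgroup.subset_closure (.inr ⟨i, hi, rfl⟩)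

theorem closure_palGenerators_mono {A B : Set (Fin n)} (h : A ⊆ B) :
    Subgroup.closure (palGenerators A) ≤ Subgroup.closure (palGenerators B) := by
  refine (Subgroup.closure_le _).2 ?_
  rintro _ (⟨i, j, hij, hi, rfl⟩ | ⟨i, hi, rfl⟩)
  · exact elementary_mem_closure hij (h hi)
  · exact inversion_mem_closure (h hi)

theorem closure_palGenerators_univ :
    Subgroup.closure (palGenerators Set.univ) = purePal n := by
  simp [palGenerators, purePal]

theorem elementary_mem_centralizer {i j : Fin n} (h : i ≠ j) :
    elementary i j h ∈ Subgroup.centralizer {invertBasis (Fin n)} := by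
  refine Subgroup.mem_centralizer_singleton_iff.2 (mulAut_ext fun l => ?_)
  obtain rfl | hl := eq_or_ne l i
  · simp [elementary_of_self, mul_assoc]
  · simp [elementary_of_ne h hl]

theorem inversion_mem_centralizer (i : Fin n) :
    inversion i ∈ Subgroup.centralizer {invertBasis (Fin n)} := by
  refine Subgroup.mem_centralizer_singleton_iff.2 (mulAut_ext fun l => ?_)
  obtain rfl | hl := eq_or_ne l i
  · simp [inversion_of_self]
  · simp [inversion_of_ne hl]

theorem elementary_mem_levelTwo {i j : Fin n} (h : i ≠ j) :
    elementary i j h ∈ levelTwo (Fin n) := by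
  refine mem_levelTwo_of_forall_of fun φ l => ?_
  obtain rfl | hl := eq_or_ne l i
  · rw [elementary_of_self, map_mul, map_mul, mul_right_comm]
    have : ∀ a b : Multiplicative (ZMod 2), a * a * b = b := by decide
    exact this _ _
  · rw [elementary_of_ne h hl]

theorem inversion_mem_levelTwo (i : Fin n) : inversion i ∈ levelTwo (Fin n) := by
  refine mem_levelTwo_of_forall_of fun φ l => ?_
  obtain rfl | hl := eq_or_ne l i
  · rw [inversion_of_self, map_inv]
    have : ∀ a : Multiplicative (ZMod 2), a⁻¹ = a := by decide
    exact this _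
  · rw [inversion_of_ne hl]

theorem purePal_le_centralizer_inf_levelTwo :
    purePal n ≤ Subgroup.centralizer {invertBasis (Fin n)} ⊓ levelTwo (Fin n) := by
  refine (Subgroup.closure_le _).2 ?_
  rintro _ (⟨i, j, hij, rfl⟩ | ⟨i, rfl⟩)
  · exact ⟨elementary_mem_centralizer hij, elementary_mem_levelTwo hij⟩
  · exact ⟨inversion_mem_centralizer i, inversion_mem_levelTwo i⟩

theorem mem_closure_palGenerators_of_eq_or_eq_inv {α : MulAut (FreeGroup (Fin n))}
    (hα : ∀ i, α (of i) = of i ∨ α (of i) = (of i)⁻¹) {s : Finset (Fin n)}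
    (hs : ∀ i ∉ s, α (of i) = of i) : α ∈ Subgroup.closure (palGenerators (s : Set (Fin n))) := by
  induction s using Finset.induction_on generalizing α with
  | empty =>
    rw [show α = 1 from mulAut_ext fun i => hs i (Finset.notMem_empty i)]
    exact one_mem _
  | insert a s _ ih =>
    have hle : Subgroup.closure (palGenerators (s : Set (Fin n))) ≤
        Subgroup.closure (palGenerators ((insert a s : Finset (Fin n)) : Set (Fin n))) :=
      closure_palGenerators_mono (Finset.coe_subset.2 (Finset.subset_insert a s))
    obtain ha | ha := hα a
    · refine hle (ih hα fun i hi => ?_)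
      obtain rfl | h := eq_or_ne i a
      · exact ha
      · exact hs i (by simp [h, hi])
    · refine (Subgroup.mul_mem_cancel_right _
        (inversion_mem_closure (Finset.mem_coe.2 (Finset.mem_insert_self a s)))).1
        (hle (ih (α := α * inversion a) (fun i => ?_) fun i hi => ?_))
      all_goals
        obtain rfl | h := eq_or_ne i a
        · simp [inversion_of_self, ha]
        · simp_all [inversion_of_ne h]

theorem exists_mem_closure_palGenerators_of_ne {A : Set (Fin n)} {i : Fin n} (hi : i ∈ A)
    {s : Fin n × Bool} (hs : s.1 ≠ i) :
    ∃ β ∈ Subgroup.closure (palGenerators A), β (of i) = mk [s] * of i * mk [s] ∧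
      ∀ l ≠ i, β (of l) = of l := by
  have hmem := elementary_mem_closure hs.symm hi
  obtain ⟨j, _ | _⟩ := s
  · exact ⟨_, inv_mem hmem, inv_elementary_of_self hs.symm,
      fun l hl => inv_elementary_of_ne hs.symm hl⟩
  · exact ⟨_, hmem, elementary_of_self hs.symm, fun l hl => elementary_of_ne hs.symm hl⟩

theorem mem_closure_palGenerators {A : Set (Fin n)} {α : MulAut (FreeGroup (Fin n))}
    (hαι : α ∈ Subgroup.centralizer {invertBasis (Fin n)}) (hα : α ∈ levelTwo (Fin n))
    (hA : ∀ i ∉ A, α (of i) = of i) : α ∈ Subgroup.closure (palGenerators A) := by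
  classical
  induction hN : ∑ i, (α (of i)).norm using Nat.strong_induction_on generalizing α with
  | _ N ih =>
    subst hN
    obtain hfix | ⟨i, s, hs, hlt⟩ := forall_apply_of_eq_or_exists_norm_lt hαι hα
    · exact closure_palGenerators_mono (by simp)
        (mem_closure_palGenerators_of_eq_or_eq_inv hfix (s := {i | i ∈ A}) (by simpa using hA))
    have hi : i ∈ A := by
      by_contra hi
      rw [hA i hi, FreeGroup.norm_of, Nat.lt_one_iff, FreeGroup.norm_eq_zero,
        map_eq_one_iff α α.injective] at hlt
      obtain ⟨β, -, hβi, -⟩ := exists_mem_closure_palGenerators_of_ne (Set.mem_univ i) hs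
      rw [← hβi, map_eq_one_iff β β.injective] at hlt
      exact FreeGroup.of_ne_one i hlt
    obtain ⟨β, hβ, hβi, hβl⟩ := exists_mem_closure_palGenerators_of_ne hi hs
    have hβ' := purePal_le_centralizer_inf_levelTwo
      (closure_palGenerators_univ.le (closure_palGenerators_mono (Set.subset_univ A) hβ))
    refine (Subgroup.mul_mem_cancel_right _ hβ).1
      (ih _ ?_ (mul_mem hαι hβ'.1) (mul_mem hα hβ'.2) (fun l hl => ?_) rfl)
    · refine Finset.sum_lt_sum (fun l _ => ?_) ⟨i, Finset.mem_univ _, ?_⟩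
      · obtain rfl | hl := eq_or_ne l i
        · rw [MulAut.mul_apply, hβi]
          exact hlt.le
        · rw [MulAut.mul_apply, hβl l hl]
      · rwa [MulAut.mul_apply, hβi]
    · rw [MulAut.mul_apply, hβl l (ne_of_mem_of_not_mem hi hl).symm, hA l hl]

theorem elementary_mem_pureFix {k : ℕ} {i j : Fin n} (h : i ≠ j) (hi : k ≤ (i : ℕ)) :
    elementary i j h ∈ pureFix n k :=
  ⟨Subgroup.subset_closure (.inl ⟨i, j, h, rfl⟩),
    fun _ hl => elementary_of_ne h (Fin.ne_of_lt (hl.trans_le hi))⟩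

theorem inversion_mem_pureFix {k : ℕ} {i : Fin n} (hi : k ≤ (i : ℕ)) :
    inversion i ∈ pureFix n k :=
  ⟨Subgroup.subset_closure (.inr ⟨i, rfl⟩),
    fun _ hl => inversion_of_ne (Fin.ne_of_lt (hl.trans_le hi))⟩

theorem pureFix_le_closure_palGenerators (n k : ℕ) :
    pureFix n k ≤ Subgroup.closure (palGenerators {i | k ≤ (i : ℕ)}) := by
  intro α hα
  obtain ⟨hι, h2⟩ := purePal_le_centralizer_inf_levelTwo hα.1
  exact mem_closure_palGenerators hι h2 fun i hi => hα.2 i (not_le.1 hi)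

end Generators

section Extension

variable {X Y : Type*} (e : Y ↪ X)

/-- The extension of an endomorphism of the free factor `F_Y` of `F_X` to the endomorphism of `F_X`
that fixes the remaining basis elements. -/
noncomputable def extendHom (f : FreeGroup Y →* FreeGroup Y) : FreeGroup X →* FreeGroup X :=
  FreeGroup.lift (Function.extend e (fun y => FreeGroup.map e (f (of y))) of)

theorem extendHom_of_apply (f : FreeGroup Y →* FreeGroup Y) (y : Y) :
    extendHom e f (of (e y)) = FreeGroup.map e (f (of y)) := by
  rw [extendHom, FreeGroup.lift_apply_of, e.injective.extend_apply]

theorem extendHom_of_notMem_range (f : FreeGroup Y →* FreeGroup Y) {x : X}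
    (hx : x ∉ Set.range e) : extendHom e f (of x) = of x := by
  rw [extendHom, FreeGroup.lift_apply_of, Function.extend_apply' _ _ _ hx]

theorem extendHom_map (f : FreeGroup Y →* FreeGroup Y) (w : FreeGroup Y) :
    extendHom e f (FreeGroup.map e w) = FreeGroup.map e (f w) := by
  suffices (extendHom e f).comp (FreeGroup.map e) = (FreeGroup.map e).comp f from
    DFunLike.congr_fun this w
  ext y
  simp [extendHom_of_apply]

theorem extendHom_comp (f g : FreeGroup Y →* FreeGroup Y) :
    extendHom e (f.comp g) = (extendHom e f).comp (extendHom e g) := by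
  refine FreeGroup.ext_hom _ _ fun x => ?_
  by_cases hx : x ∈ Set.range e
  · obtain ⟨y, rfl⟩ := hx
    simp [extendHom_of_apply, extendHom_map]
  · simp [extendHom_of_notMem_range e _ hx]

theorem extendHom_id : extendHom e (MonoidHom.id _) = MonoidHom.id _ := by
  refine FreeGroup.ext_hom _ _ fun x => ?_
  by_cases hx : x ∈ Set.range e
  · obtain ⟨y, rfl⟩ := hx
    simp [extendHom_of_apply]
  · simp [extendHom_of_notMem_range e _ hx]

/-- The extension of automorphisms of the free factor `F_Y` of `F_X` to automorphisms of `F_X` that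
fix the remaining basis elements. -/
noncomputable def extendAut : MulAut (FreeGroup Y) →* MulAut (FreeGroup X) where
  toFun β := MonoidHom.toMulEquiv (extendHom e β.toMonoidHom) (extendHom e β.symm.toMonoidHom)
    (by rw [← extendHom_comp, ← extendHom_id]; congr 1; ext; simp)
    (by rw [← extendHom_comp, ← extendHom_id]; congr 1; ext; simp)
  map_one' := MulEquiv.ext fun w => DFunLike.congr_fun (extendHom_id e) w
  map_mul' α β := MulEquiv.ext fun w =>
    DFunLike.congr_fun (extendHom_comp e α.toMonoidHom β.toMonoidHom) w

theorem extendAut_of_apply (β : MulAut (FreeGroup Y)) (y : Y) :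
    extendAut e β (of (e y)) = FreeGroup.map e (β (of y)) :=
  extendHom_of_apply e _ y

theorem extendAut_of_notMem_range (β : MulAut (FreeGroup Y)) {x : X} (hx : x ∉ Set.range e) :
    extendAut e β (of x) = of x :=
  extendHom_of_notMem_range e _ hx

end Extension

theorem extendAut_elementary {m n : ℕ} (e : Fin m ↪ Fin n) {i j : Fin m} (h : i ≠ j) :
    extendAut e (elementary i j h) = elementary (e i) (e j) (e.injective.ne h) := by
  refine mulAut_ext fun l => ?_
  by_cases hl : l ∈ Set.range e
  · obtain ⟨y, rfl⟩ := hl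
    obtain rfl | hy := eq_or_ne y i
    · simp [extendAut_of_apply, elementary_of_self]
    · rw [extendAut_of_apply, elementary_of_ne _ hy, elementary_of_ne _ (e.injective.ne hy),
        FreeGroup.map.of]
  · rw [extendAut_of_notMem_range e _ hl, elementary_of_ne _ fun h => hl ⟨i, h.symm⟩]

theorem extendAut_inversion {m n : ℕ} (e : Fin m ↪ Fin n) (i : Fin m) :
    extendAut e (inversion i) = inversion (e i) := by
  refine mulAut_ext fun l => ?_
  by_cases hl : l ∈ Set.range e
  · obtain ⟨y, rfl⟩ := hl
    obtain rfl | hy := eq_or_ne y i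
    · simp [extendAut_of_apply, inversion_of_self]
    · rw [extendAut_of_apply, inversion_of_ne hy, inversion_of_ne (e.injective.ne hy),
        FreeGroup.map.of]
  · rw [extendAut_of_notMem_range e _ hl, inversion_of_ne fun h => hl ⟨i, h.symm⟩]

section BirmanSequence

theorem ker_eq_of_sup_range_eq_top {G Q : Type*} [Group G] [Group Q] {π : G →* Q} {σ : Q →* G}
    {N : Subgroup G} [N.Normal] (hN : N ≤ π.ker) (hσ : Function.RightInverse σ π)
    (h : N ⊔ σ.range = ⊤) : π.ker = N := by
  refine le_antisymm (fun g hg => ?_) hN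
  obtain ⟨a, ha, _, ⟨q, rfl⟩, rfl⟩ :=
    Subgroup.mem_sup_of_normal_left.1 (h.ge (Subgroup.mem_top g))
  rw [MonoidHom.mem_ker, map_mul, hN ha, one_mul, hσ] at hg
  rwa [hg, map_one, mul_one]

variable (n k : ℕ)

/-- The position in the basis of `F_n` of the basis elements of `F_{n-k}`. -/
def shiftIndex : Fin (n - k) ↪ Fin n where
  toFun y := ⟨y + k, by omega⟩
  inj' a b h := Fin.ext (by simpa using h)

variable {n k}

theorem val_shiftIndex (y : Fin (n - k)) : (shiftIndex n k y : ℕ) = y + k := rfl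

theorem mem_range_shiftIndex {i : Fin n} : i ∈ Set.range (shiftIndex n k) ↔ k ≤ (i : ℕ) := by
  refine ⟨?_, fun hi => ⟨⟨i - k, by omega⟩, Fin.ext (Nat.sub_add_cancel hi)⟩⟩
  rintro ⟨y, rfl⟩
  exact Nat.le_add_left _ _

theorem le_shiftIndex (y : Fin (n - k)) : k ≤ (shiftIndex n k y : ℕ) :=
  mem_range_shiftIndex.1 ⟨y, rfl⟩

theorem kill_of_shiftIndex (y : Fin (n - k)) : kill n k (of (shiftIndex n k y)) = of y := by
  simp [kill, val_shiftIndex]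

theorem kill_of_lt {i : Fin n} (h : (i : ℕ) < k) : kill n k (of i) = 1 := by
  simp [kill, h]

theorem kill_map_shiftIndex (w : FreeGroup (Fin (n - k))) :
    kill n k (FreeGroup.map (shiftIndex n k) w) = w := by
  suffices (kill n k).comp (FreeGroup.map (shiftIndex n k)) = MonoidHom.id _ from
    DFunLike.congr_fun this w
  ext y
  simp [kill_of_shiftIndex]

theorem kill_apply_map_shiftIndex_kill {α : MulAut (FreeGroup (Fin n))}
    (hα : ∀ i : Fin n, (i : ℕ) < k → α (of i) = of i) (w : FreeGroup (Fin n)) :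
    kill n k (α (FreeGroup.map (shiftIndex n k) (kill n k w))) = kill n k (α w) := by
  suffices ((kill n k).comp α.toMonoidHom).comp ((FreeGroup.map (shiftIndex n k)).comp
      (kill n k)) = (kill n k).comp α.toMonoidHom from DFunLike.congr_fun this w
  refine FreeGroup.ext_hom _ _ fun i => ?_
  obtain hi | hi := lt_or_ge (i : ℕ) k
  · simp [kill_of_lt hi, hα i hi]
  · obtain ⟨y, rfl⟩ := mem_range_shiftIndex.2 hi
    simp [kill_of_shiftIndex]

variable (n k) in
/-- The action on `F_{n-k}`, the quotient of `F_n` by the normal closure of the first `k` basis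
elements, of the automorphisms in `PΠA_n(k)`. -/
def induced : pureFix n k →* MulAut (FreeGroup (Fin (n - k))) where
  toFun α := MonoidHom.toMulEquiv
    (((kill n k).comp α.1.toMonoidHom).comp (FreeGroup.map (shiftIndex n k)))
    (((kill n k).comp (α⁻¹).1.toMonoidHom).comp (FreeGroup.map (shiftIndex n k)))
    (by
      ext y
      exact (kill_apply_map_shiftIndex_kill (inv_mem α.2).2 _).trans (by simp [kill_of_shiftIndex]))
    (by ext y; simp [kill_apply_map_shiftIndex_kill α.2.2, kill_of_shiftIndex])
  map_one' := mulAut_ext fun y => by simp [kill_of_shiftIndex]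
  map_mul' α β := mulAut_ext fun y => by simp [kill_apply_map_shiftIndex_kill α.2.2]

theorem induced_kill (α : pureFix n k) (w : FreeGroup (Fin n)) :
    induced n k α (kill n k w) = kill n k (α.1 w) :=
  kill_apply_map_shiftIndex_kill α.2.2 w

theorem induced_of (α : pureFix n k) (y : Fin (n - k)) :
    induced n k α (of y) = kill n k (α.1 (of (shiftIndex n k y))) := by
  rw [← induced_kill, kill_of_shiftIndex]

theorem extendAut_shiftIndex_mem_pureFix {β : MulAut (FreeGroup (Fin (n - k)))}
    (hβ : β ∈ purePal (n - k)) : extendAut (shiftIndex n k) β ∈ pureFix n k := by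
  suffices purePal (n - k) ≤ (pureFix n k).comap (extendAut (shiftIndex n k)) from this hβ
  refine (Subgroup.closure_le _).2 ?_
  rintro _ (⟨i, j, hij, rfl⟩ | ⟨i, rfl⟩)
  · rw [SetLike.mem_coe, Subgroup.mem_comap, extendAut_elementary]
    exact elementary_mem_pureFix _ (le_shiftIndex i)
  · rw [SetLike.mem_coe, Subgroup.mem_comap, extendAut_inversion]
    exact inversion_mem_pureFix (le_shiftIndex i)

variable (n k) in
/-- The section of `θ_*` that extends an automorphism by the identity on the first `k` basis
elements. -/
noncomputable def extendPal : purePal (n - k) →* pureFix n k :=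
  ((extendAut (shiftIndex n k)).comp (purePal (n - k)).subtype).codRestrict _
    fun β => extendAut_shiftIndex_mem_pureFix β.2

theorem induced_extendPal (β : purePal (n - k)) : induced n k (extendPal n k β) = β := by
  refine mulAut_ext fun y => ?_
  rw [induced_of, ← kill_map_shiftIndex (β.1 (of y)), ← extendAut_of_apply]
  rfl

instance birmanKernel_normal : (birmanKernel n k).Normal := Subgroup.normalClosure_normal

theorem birmanKernel_le_ker_induced : birmanKernel n k ≤ (induced n k).ker := by
  refine Subgroup.normalClosure_le_normal ?_
  rintro α ⟨i, j, hij, hi, hj, hα⟩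
  refine mulAut_ext fun y => ?_
  rw [induced_of, hα, MulAut.one_apply]
  obtain rfl | hy := eq_or_ne (shiftIndex n k y) i
  · simp [elementary_of_self, kill_of_lt hj, kill_of_shiftIndex]
  · rw [elementary_of_ne _ hy, kill_of_shiftIndex]

theorem birmanKernel_sup_range_extendPal : birmanKernel n k ⊔ (extendPal n k).range = ⊤ := by
  suffices Subgroup.closure (palGenerators {i | k ≤ (i : ℕ)}) ≤
      (birmanKernel n k ⊔ (extendPal n k).range).map (pureFix n k).subtype by
    refine eq_top_iff.2 fun α _ => ?_
    obtain ⟨β, hβ, h⟩ := this (pureFix_le_closure_palGenerators n k α.2)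
    rwa [← Subtype.ext h]
  refine (Subgroup.closure_le _).2 ?_
  rintro _ (⟨i, j, hij, hi, rfl⟩ | ⟨i, hi, rfl⟩)
  · refine ⟨⟨_, elementary_mem_pureFix hij hi⟩, ?_, rfl⟩
    obtain hj | hj := lt_or_ge (j : ℕ) k
    · exact Subgroup.mem_sup_left (Subgroup.subset_normalClosure ⟨i, j, hij, hi, hj, rfl⟩)
    · obtain ⟨y, rfl⟩ := mem_range_shiftIndex.2 hi
      obtain ⟨z, rfl⟩ := mem_range_shiftIndex.2 hj
      have hyz : y ≠ z := ne_of_apply_ne _ hij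
      exact Subgroup.mem_sup_right ⟨⟨_, Subgroup.subset_closure (.inl ⟨y, z, hyz, rfl⟩)⟩,
        Subtype.ext (extendAut_elementary _ hyz)⟩
  · obtain ⟨y, rfl⟩ := mem_range_shiftIndex.2 hi
    exact ⟨⟨_, inversion_mem_pureFix hi⟩, Subgroup.mem_sup_right
      ⟨⟨_, Subgroup.subset_closure (.inr ⟨y, rfl⟩)⟩, Subtype.ext (extendAut_inversion _ y)⟩, rfl⟩

theorem range_induced_le_purePal : (induced n k).range ≤ purePal (n - k) := by
  rw [MonoidHom.range_eq_map, ← birmanKernel_sup_range_extendPal, Subgroup.map_sup,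
    (Subgroup.map_eq_bot_iff _).2 birmanKernel_le_ker_induced, bot_sup_eq, ← MonoidHom.range_comp]
  rintro _ ⟨β, rfl⟩
  exact (induced_extendPal β).symm ▸ β.2

variable (n k) in
/-- The homomorphism `θ_*` from `PΠA_n(k)` to `PΠA_{n-k}`. -/
def theta : pureFix n k →* purePal (n - k) :=
  (induced n k).codRestrict _ fun α => range_induced_le_purePal ⟨α, rfl⟩

theorem rightInverse_extendPal_theta :
    Function.RightInverse (extendPal n k) (theta n k) :=
  fun β => Subtype.ext (induced_extendPal β)

theorem ker_theta : (theta n k).ker = birmanKernel n k :=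
  ker_eq_of_sup_range_eq_top
    (birmanKernel_le_ker_induced.trans_eq (MonoidHom.ker_codRestrict _ _ _).symm)
    rightInverse_extendPal_theta birmanKernel_sup_range_extendPal

variable (n k) in
/-- The Birman exact sequence `1 → J_n(k) → PΠA_n(k) → PΠA_{n-k} → 1`. -/
def birmanExtension :
    GroupExtension (birmanKernel n k) (pureFix n k) (purePal (n - k)) where
  inl := (birmanKernel n k).subtype
  rightHom := theta n k
  inl_injective := Subtype.val_injective
  range_inl_eq_ker_rightHom := by rw [Subgroup.range_subtype, ker_theta]
  rightHom_surjective := rightInverse_extendPal_theta.surjective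

end BirmanSequence

end Palindromic

theorem mainTheorem11 (n k : ℕ) (hk : k ≤ n) :
    ∃ S : GroupExtension (Palindromic.birmanKernel n k) (Palindromic.pureFix n k)
        (Palindromic.purePal (n - k)),
      S.inl = (Palindromic.birmanKernel n k).subtype ∧
      (∀ (α : Palindromic.pureFix n k) (w : FreeGroup (Fin n)),
        (S.rightHom α : MulAut (FreeGroup (Fin (n - k)))) (Palindromic.kill n k w) =
          Palindromic.kill n k ((α : MulAut (FreeGroup (Fin n))) w)) ∧
      Nonempty S.Splitting :=
  ⟨Palindromic.birmanExtension n k, rfl, Palindromic.induced_kill,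
    ⟨{ Palindromic.extendPal n k with
        rightInverse_rightHom := Palindromic.rightInverse_extendPal_theta }⟩⟩
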